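/- Let $H$ be the group of diagonal matrices in $\mathrm{GL}(n,\mathbb{C})$, and let $\chi_1,\dots,\chi_m : H \to \mathbb{C}^*$ be algebraic homomorphisms. Each $\chi_i$ is identified with the vector $\mathbf{a}_i = (a_{i,1},\dots,a_{i,n}) \in \mathbb{Z}^n$ such that $\chi_i(h_1,\dots,h_n) = \prod_{j=1}^n h_j^{a_{i,j}}$. Let $H$ act on $\mathbb{A}^m = \mathbb{C}^m$ by $$h\cdot(z_1,\dots,z_m) = (\chi_1(h)z_1,\dots,\chi_m(h)z_m).$$ For $z \in \mathbb{A}^m$ let $X(z)$ be the Zariski closure of the orbit $H\cdot z$, and let $A = A(z) = \{\mathbf{a}_i \mid z_i \neq 0\} \subset \mathbb{Z}^n$. Write $\mathbb{Z}(A)$ for the subgroup of $\mathbb{Z}^n$ generated by $A$, $\mathbb{N}(A)$ for the set of all non-negative integral combinations of elements of $A$ (including $0$), and $\mathbb{Q}_0^+(A) \subset \mathbb{Q}^n$ for the set of all non-negative rational combinations of elements of $A$. Then $X(z)$ is isomorphic, as an affine variety, to the affine toric variety $V \subset \mathbb{C}^{A}$ defined by $A$, that is, to the zero set of the kernel of the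 homomorphism $\mathbb{C}[x_a : a \in A] \to \mathbb{C}[\mathbb{N}(A)]$ sending $x_a$ to the basis element of the semigroup algebra $\mathbb{C}[\mathbb{N}(A)]$ corresponding to $a$; and the coordinate ring of $X(z)$ is isomorphic to $\mathbb{C}[\mathbb{N}(A)]$ as a $\mathbb{C}$-algebra. Hence $X(z)$ is normal (its coordinate ring is an integral domain that is integrally closed in its field of fractions) if and only if $$\mathbb{Z}(A) \cap \mathbb{Q}_0^+(A) = \mathbb{N}(A).$$ -/

import Mathlib

namespace OrbitClosure

noncomputable section

/-- The group of diagonal matrices in `GL(n, ℂ)`. -/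
def diagTorus (n : ℕ) : Subgroup (GL (Fin n) ℂ) where
  carrier := {g | (g : Matrix (Fin n) (Fin n) ℂ).IsDiag}
  one_mem' := Matrix.isDiag_one
  mul_mem' := by
    intro a b ha hb
    simp only [Set.mem_ofPred_eq, Units.val_mul] at *
    rw [← (Matrix.isDiag_iff_diagonal_diag _).1 ha, ← (Matrix.isDiag_iff_diagonal_diag _).1 hb,
      Matrix.diagonal_mul_diagonal]
    exact Matrix.isDiag_diagonal _
  inv_mem' := by
    intro a ha
    simp only [Set.mem_ofPred_eq, Matrix.coe_units_inv] at *
    rw [← (Matrix.isDiag_iff_diagonal_diag _).1 ha, Matrix.inv_diagonal]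
    exact Matrix.isDiag_diagonal _

/-- The `j`-th diagonal entry of `h`. -/
def coord {n : ℕ} (h : diagTorus n) (j : Fin n) : ℂ :=
  ((h : GL (Fin n) ℂ) : Matrix (Fin n) (Fin n) ℂ) j j

/-- A homomorphism `χ : H → ℂ*` is algebraic (a character) if it is a regular function on `H`,
that is, a polynomial in the diagonal entries divided by a power of their (nowhere vanishing)
product. -/
def IsAlgebraic {n : ℕ} (χ : diagTorus n →* ℂˣ) : Prop :=
  ∃ (p : MvPolynomial (Fin n) ℂ) (k : ℕ), ∀ h : diagTorus n,
    (χ h : ℂ) = MvPolynomial.eval (coord h) p / (∏ j, coord h j) ^ k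

/-- `a ∈ ℤⁿ` is the exponent vector of `χ`, i.e. `χ(h) = ∏ⱼ hⱼ ^ aⱼ` on `H`. -/
def HasExponent {n : ℕ} (χ : diagTorus n →* ℂˣ) (a : Fin n → ℤ) : Prop :=
  ∀ h : diagTorus n, (χ h : ℂ) = ∏ j, coord h j ^ a j

/-- The orbit `H · z` for the action `h · z = (χ₁(h) z₁, …, χₘ(h) zₘ)` on `𝔸ᵐ`. -/
def torusOrbit {n m : ℕ} (χ : Fin m → (diagTorus n →* ℂˣ)) (z : Fin m → ℂ) :
    Set (Fin m → ℂ) :=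
  {w | ∃ h : diagTorus n, w = fun i => (χ i h : ℂ) * z i}

/-- The Zariski closure of a subset of affine space. -/
def zariskiClosure {σ : Type*} (S : Set (σ → ℂ)) : Set (σ → ℂ) :=
  MvPolynomial.zeroLocus ℂ (MvPolynomial.vanishingIdeal ℂ S)

/-- The orbit closure `X(z)`. -/
def orbitClosure {n m : ℕ} (χ : Fin m → (diagTorus n →* ℂˣ)) (z : Fin m → ℂ) :
    Set (Fin m → ℂ) :=
  zariskiClosure (torusOrbit χ z)

/-- The set `A(z) = {χᵢ | zᵢ ≠ 0}`, characters being identified with their exponent vectors. -/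
def supportCharacters {n m : ℕ} (χ : Fin m → (diagTorus n →* ℂˣ)) (z : Fin m → ℂ) :
    Set (Fin n → ℤ) :=
  {a | ∃ i, z i ≠ 0 ∧ HasExponent (χ i) a}

/-- The coordinate ring `ℂ[X]` of an algebraic subset of affine space. -/
abbrev CoordRing {σ : Type*} (X : Set (σ → ℂ)) : Type _ :=
  MvPolynomial σ ℂ ⧸ MvPolynomial.vanishingIdeal ℂ X

/-- Normality: the coordinate ring is a domain, integrally closed in its field of fractions. -/
def IsNormalVariety {σ : Type*} (X : Set (σ → ℂ)) : Prop :=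
  IsDomain (CoordRing X) ∧ IsIntegrallyClosed (CoordRing X)

/-- Isomorphism of affine algebraic sets: mutually inverse polynomial maps. -/
def VarietyIso {σ τ : Type*} (X : Set (σ → ℂ)) (Y : Set (τ → ℂ)) : Prop :=
  ∃ (f : τ → MvPolynomial σ ℂ) (g : σ → MvPolynomial τ ℂ),
    (∀ x ∈ X, (fun j => MvPolynomial.eval x (f j)) ∈ Y) ∧
    (∀ y ∈ Y, (fun i => MvPolynomial.eval y (g i)) ∈ X) ∧
    (∀ x ∈ X, (fun i => MvPolynomial.eval (fun j => MvPolynomial.eval x (f j)) (g i)) = x) ∧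
    (∀ y ∈ Y, (fun j => MvPolynomial.eval (fun i => MvPolynomial.eval y (g i)) (f j)) = y)

/-- The semigroup algebra `ℂ[ℕ(A)]`. -/
abbrev SemigroupAlgebra {n : ℕ} (A : Set (Fin n → ℤ)) : Type :=
  AddMonoidAlgebra ℂ (AddSubmonoid.closure A)

/-- The toric ideal of `A`: the kernel of `ℂ[x_a : a ∈ A] → ℂ[ℕ(A)]`, `x_a ↦ χ^a`. -/
def toricIdeal {n : ℕ} (A : Set (Fin n → ℤ)) : Ideal (MvPolynomial A ℂ) :=
  RingHom.ker (MvPolynomial.aeval (R := ℂ) (fun a : A =>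
    (AddMonoidAlgebra.single ⟨a.1, AddSubmonoid.subset_closure a.2⟩ 1 : SemigroupAlgebra A)))

/-- The affine toric variety `V ⊆ ℂ^A` of the semigroup algebra `ℂ[ℕ(A)]`. -/
def affineToricVariety {n : ℕ} (A : Set (Fin n → ℤ)) : Set (A → ℂ) :=
  MvPolynomial.zeroLocus ℂ (toricIdeal A)

/-- The rational cone of non-negative rational combinations of elements of `A`, in `ℚⁿ`. -/
def rationalCone {n : ℕ} (A : Set (Fin n → ℤ)) : Set (Fin n → ℚ) :=
  PointedCone.hull ℚ ((fun (a : Fin n → ℤ) (j : Fin n) => (a j : ℚ)) '' A)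

/-- The condition `ℤ(A) ∩ ℚ₀⁺(A) = ℕ(A)`, an equality of subsets of `ℤⁿ`. -/
def IsSaturated {n : ℕ} (A : Set (Fin n → ℤ)) : Prop :=
  (AddSubgroup.closure A : Set (Fin n → ℤ)) ∩ {v | (fun j => (v j : ℚ)) ∈ rationalCone A} =
    (AddSubmonoid.closure A : Set (Fin n → ℤ))

end

end OrbitClosure

/-! A polynomial vanishes on the orbit iff its pullback along `h ↦ h·z`, an element of ℂ[ℕ(A)],
vanishes at every point of the torus. Distinct Laurent monomials are distinct characters, hence
linearly independent (Dedekind), so the ideal of X(z) is the kernel of `xᵢ ↦ zᵢ χᵢ`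
(`vanishingIdeal_torusOrbit`). That map is onto ℂ[ℕ(A)], as is the toric presentation, and two
presentations of one algebra cut out isomorphic varieties (`varietyIso_zeroLocus_ker`).

Normality is then a question about ℂ[ℕ(A)] inside ℂ[ℤ(A)], a Laurent polynomial ring and so
integrally closed. Characters act on the integral closure, which is therefore spanned by monomials;
a monomial is integral only if a positive multiple of its exponent lies in ℕ(A)
(`isIntegrallyClosed_iff_of_generates`). Clearing denominators identifies such exponents with the
lattice points of the cone (`cast_mem_rationalCone_iff`). -/

namespace AddMonoidAlgebra

/-! ### Laurent polynomial rings are integrally closed -/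

section Laurent

variable (k ι : Type*) [Field k]

/-- The inclusion of the polynomial ring in the ring of Laurent polynomials. -/
noncomputable def polynomialToLaurent : MvPolynomial ι k →+* AddMonoidAlgebra k (ι →₀ ℤ) :=
  mapDomainRingHom k (Finsupp.mapRange.addMonoidHom (Nat.castAddMonoidHom ℤ))

variable {k ι}

lemma polynomialToLaurent_single (d : ι →₀ ℕ) (c : k) :
    polynomialToLaurent k ι (single d c) = single (d.mapRange (Nat.cast : ℕ → ℤ) rfl) c := by
  simp [polynomialToLaurent]

lemma polynomialToLaurent_injective : Function.Injective (polynomialToLaurent k ι) :=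
  mapDomain_injective (Finsupp.mapRange_injective _ rfl Nat.cast_injective)

lemma exists_mul_single_mem_range (f : AddMonoidAlgebra k (ι →₀ ℤ)) :
    ∃ (d : ι →₀ ℕ) (p : MvPolynomial ι k),
      f * polynomialToLaurent k ι (single d 1) = polynomialToLaurent k ι p := by
  induction f using induction_linear with
  | zero => exact ⟨0, 0, by simp⟩
  | add f g hf hg =>
    obtain ⟨d, p, hp⟩ := hf
    obtain ⟨e, q, hq⟩ := hg
    refine ⟨d + e, p * single e 1 + q * single d 1, ?_⟩
    have : (single (d + e) 1 : MvPolynomial ι k) = single d 1 * single e 1 := by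
      simp [single_mul_single]
    rw [this]
    simp only [map_mul, map_add, ← hp, ← hq]
    ring
  | single v c =>
    -- Write v = v⁺ - v⁻; multiplying by the monomial of exponent v⁻ leaves the one of exponent v⁺.
    refine ⟨v.mapRange (fun x => (-x).toNat) rfl, single (v.mapRange Int.toNat rfl) c, ?_⟩
    simp only [polynomialToLaurent_single, single_mul_single, mul_one]
    congr 1
    ext i
    simp
    omega

/-- Laurent polynomial rings over a field are integrally closed. -/
theorem isIntegrallyClosed_laurent : IsIntegrallyClosed (AddMonoidAlgebra k (ι →₀ ℤ)) := by
  let := (polynomialToLaurent k ι).toAlgebra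
  -- Laurent polynomials are the polynomial ring, itself integrally closed, localized at its
  -- monomials.
  let M : Submonoid (MvPolynomial ι k) :=
    MonoidHom.mrange (AddMonoidAlgebra.of k (ι →₀ ℕ))
  have hM : M ≤ nonZeroDivisors _ := by
    rintro _ ⟨d, rfl⟩
    refine mem_nonZeroDivisors_of_ne_zero ?_
    simp [of]
  have : IsLocalization M (AddMonoidAlgebra k (ι →₀ ℤ)) := by
    refine (isLocalization_iff M _).2 ⟨?_, ?_, ?_⟩
    · rintro ⟨_, d, rfl⟩
      refine IsUnit.of_mul_eq_one (single (-(d.toAdd.mapRange (Nat.cast : ℕ → ℤ) rfl)) 1) ?_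
      change polynomialToLaurent k ι (single _ _) * _ = _
      rw [polynomialToLaurent_single, single_mul_single, add_neg_cancel, mul_one, one_def]
    · intro f
      obtain ⟨d, p, h⟩ := exists_mul_single_mem_range f
      exact ⟨⟨p, ⟨_, .ofAdd d, rfl⟩⟩, h⟩
    · intro x y h
      exact ⟨1, by rw [polynomialToLaurent_injective h]⟩
  exact isIntegrallyClosed_of_isLocalization _ M hM

/-- The group algebra of a free abelian group over a field is integrally closed. -/
theorem isIntegrallyClosed_of_free (M : Type*) [AddCommGroup M] [Module.Free ℤ M] :
    IsIntegrallyClosed (AddMonoidAlgebra k M) :=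
  have := isIntegrallyClosed_laurent (k := k) (ι := Module.Free.ChooseBasisIndex ℤ M)
  .of_equiv (domCongr k k (Module.Free.chooseBasis ℤ M).repr.toAddEquiv).symm.toRingEquiv

end Laurent

/-! ### Integral closure of a monoid algebra in a group algebra -/

section Integral

variable {k G : Type*} [Field k] [AddCommGroup G]

/-- The automorphism of `k[M]` scaling the monomial of exponent `m` by `χ m`. -/
noncomputable def twist {M : Type*} [AddCommMonoid M] (χ : Multiplicative M →* k) :
    AddMonoidAlgebra k M →ₐ[k] AddMonoidAlgebra k M :=
  lift k _ M
    { toFun := fun m => single m.toAdd (χ m)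
      map_one' := by simp [one_def]
      map_mul' := by simp [single_mul_single] }

lemma twist_single {M : Type*} [AddCommMonoid M] (χ : Multiplicative M →* k) (m : M) (c : k) :
    twist χ (single m c) = single m (c * χ (.ofAdd m)) := by
  simp [twist]

lemma coeff_twist {M : Type*} [AddCommMonoid M] (χ : Multiplicative M →* k)
    (f : AddMonoidAlgebra k M) (m : M) :
    (twist χ f).coeff m = f.coeff m * χ (.ofAdd m) := by
  classical
  induction f using induction_linear with
  | zero => simp
  | add f g hf hg => simp [hf, hg, add_mul]
  | single v c =>
    rw [twist_single]
    simp only [coeff_single, Finsupp.single_apply]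
    split_ifs with h <;> simp [h]

lemma twist_mapDomainRingHom {M : Type*} [AddCommMonoid M] (φ : M →+ G)
    (χ : Multiplicative G →* k) (f : AddMonoidAlgebra k M) :
    twist χ (mapDomainRingHom k φ f) =
      mapDomainRingHom k φ (twist (χ.comp φ.toMultiplicative) f) := by
  induction f using induction_linear with
  | zero => simp
  | add f g hf hg => simp only [map_add, hf, hg]
  | single v c => simp [twist_single]

variable {M : Type*} [AddCommMonoid M] (φ : M →+ G)

/-- Twisting is a ring map compatible with the inclusion of k[M], so it carries one monic equation
over k[M] to another. -/
lemma isIntegralElem_twist  (χ : Multiplicative G →* k)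
    {f : AddMonoidAlgebra k G} (hf : (mapDomainRingHom k φ).IsIntegralElem f) :
    (mapDomainRingHom k φ).IsIntegralElem (twist χ f) := by
  obtain ⟨p, hp, h⟩ := hf
  refine ⟨p.map (twist (χ.comp φ.toMultiplicative)).toRingHom, hp.map _, ?_⟩
  have := congrArg (twist χ).toRingHom h
  rw [Polynomial.hom_eval₂, map_zero] at this
  rw [Polynomial.eval₂_map]
  convert this using 1
  congr 1
  exact RingHom.ext fun g => (twist_mapDomainRingHom φ χ g).symm

lemma isIntegralElem_smul  (c : k)
    {f : AddMonoidAlgebra k G} (hf : (mapDomainRingHom k φ).IsIntegralElem f) :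
    (mapDomainRingHom k φ).IsIntegralElem (c • f) := by
  have : c • f = mapDomainRingHom k φ (single 0 c) * f := by
    ext v
    simp
  rw [this]
  exact ((mapDomainRingHom k φ).isIntegralElem_map).mul _ hf

/-- If characters separate the points of `G`, the integral closure of `k[M]` in `k[G]` is spanned
by monomials. -/
lemma isIntegralElem_single 
    (hsep : ∀ v w : G, v ≠ w → ∃ χ : Multiplicative G →* k, χ (.ofAdd v) ≠ χ (.ofAdd w))
    (f : AddMonoidAlgebra k G) (hf : (mapDomainRingHom k φ).IsIntegralElem f)
    {v : G} (hv : v ∈ f.coeff.support) : (mapDomainRingHom k φ).IsIntegralElem (single v 1) := by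
  induction hN : f.coeff.support.card using Nat.strong_induction_on generalizing f with
  | _ N ih =>
  subst hN
  by_cases h : ∃ w ∈ f.coeff.support, w ≠ v
  · obtain ⟨w, hw, hwv⟩ := h
    obtain ⟨χ, hχ⟩ := hsep w v hwv
    -- This combination loses the exponent w, keeps v, and gains no new exponent, so induction on
    -- the size of the support applies.
    have key : ∀ u, (twist χ f - χ (.ofAdd w) • f).coeff u =
        f.coeff u * (χ (.ofAdd u) - χ (.ofAdd w)) := by
      intro u
      simp [coeff_twist]
      ring
    refine ih _ ?_ (twist χ f - χ (.ofAdd w) • f)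
      ((isIntegralElem_twist φ χ hf).sub _ (isIntegralElem_smul φ _ hf)) ?_ rfl
    · refine Finset.card_lt_card ⟨fun u hu => ?_, fun hsub => ?_⟩
      · rw [Finsupp.mem_support_iff, key] at hu
        exact Finsupp.mem_support_iff.2 (left_ne_zero_of_mul hu)
      · have := hsub hw
        rw [Finsupp.mem_support_iff, key] at this
        simp at this
    · rw [Finsupp.mem_support_iff, key]
      exact mul_ne_zero (Finsupp.mem_support_iff.1 hv) (sub_ne_zero.2 hχ.symm)
  · push Not at h
    have hfv : f = single v (f.coeff v) := by
      ext u
      by_cases hu : u = v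
      · simp [hu]
      · have : f.coeff u = 0 := by
          by_contra h0
          exact hu (h u (Finsupp.mem_support_iff.2 h0))
        simp [this, Ne.symm hu]
    have : (single v 1 : AddMonoidAlgebra k G) = (f.coeff v)⁻¹ • f := by
      rw [hfv]
      simp [inv_mul_cancel₀ (Finsupp.mem_support_iff.1 hv)]
    rw [this]
    exact isIntegralElem_smul φ _ hf

/-- A monomial that is integral over `k[M]` has a positive power in `k[M]`. -/
lemma exists_nsmul_mem_of_isIntegralElem_single  {v : G}
    (hv : (mapDomainRingHom k φ).IsIntegralElem (single v 1)) : ∃ d, 0 < d ∧ d • v ∈ Set.range φ := by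
  obtain ⟨p, hp, h⟩ := hv
  rw [Polynomial.eval₂_eq_sum_range, Finset.sum_range_succ, hp.coeff_natDegree, map_one,
    one_mul] at h
  -- Read off the coefficient at N • v, with N the degree. The term of index i < N contributes the
  -- coefficient at (N - i) • v of an element of k[M], which is zero if no positive multiple of v
  -- lies in M.
  have h' := congrArg (fun f : AddMonoidAlgebra k G => f.coeff (p.natDegree • v)) h
  simp only [coeff_add, coeff_sum, Finsupp.add_apply, Finsupp.finsetSum_apply, single_pow, one_pow,
    coeff_mul_single_apply, mul_one, coeff_single, Finsupp.single_eq_same, coeff_zero,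
    Finsupp.zero_apply] at h'
  by_contra! hS
  rw [Finset.sum_eq_zero, zero_add] at h'
  · exact one_ne_zero h'
  · intro i hi
    rw [Finset.mem_range] at hi
    refine Finsupp.mapDomain_of_notMem_range _ _ ?_
    have := hS (p.natDegree - i) (by omega)
    rwa [sub_nsmul _ hi.le] at this

/-- With g = φ a - φ b, the hypothesis on d • g says that the d-th power of the monomial of b
divides that of a. In an integrally closed domain the d-th powers can be dropped, and the quotient
has the exponent g in its support. -/
lemma mem_range_of_nsmul_mem_range [UniqueSums G] (hφ : Function.Injective φ)
    (hgen : ∀ g : G, ∃ a b : M, g + φ b = φ a) (h : IsIntegrallyClosed (AddMonoidAlgebra k M))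
    {g : G} {d : ℕ} (hd : 0 < d) (hg : d • g ∈ Set.range φ) : g ∈ Set.range φ := by
  have : UniqueSums M := .of_injective_addHom φ.toAddHom hφ inferInstance
  obtain ⟨c, hc⟩ := hg
  obtain ⟨a, b, hab⟩ := hgen g
  have hdvd : (single b 1 : AddMonoidAlgebra k M) ^ d ∣ single a 1 ^ d := by
    refine ⟨single c 1, ?_⟩
    simp only [single_pow, one_pow, single_mul_single, mul_one]
    congr 1
    apply hφ
    simp only [map_add, map_nsmul, hc, ← hab, nsmul_add, add_comm]
  obtain ⟨q, hq⟩ := (IsIntegrallyClosed.pow_dvd_pow_iff hd.ne').1 hdvd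
  have hcoeff : (mapDomainRingHom k φ (single a 1)).coeff (φ a) =
      (mapDomainRingHom k φ q * single (φ b) 1).coeff (φ a) := by
    rw [hq, map_mul, mul_comm]
    simp
  by_contra hg
  have h0 : (mapDomainRingHom k φ q).coeff g = 0 := Finsupp.mapDomain_of_notMem_range _ _ hg
  rw [coeff_mul_single_apply, ← hab, add_neg_cancel_right, h0] at hcoeff
  simp [hab] at hcoeff

lemma exists_fractionField_hom {R S K L : Type*} [CommRing R] [CommRing S] [Field K] [Field L]
    [Algebra R K] [IsFractionRing R K] [Algebra S L] [IsFractionRing S L] (i : R →+* S)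
    (hi : Function.Injective i) :
    ∃ J : K →+* L, J.comp (algebraMap R K) = (algebraMap S L).comp i :=
  have hj : Function.Injective ((algebraMap S L).comp i) := (IsFractionRing.injective S L).comp hi
  ⟨IsFractionRing.lift hj, RingHom.ext (IsFractionRing.lift_algebraMap hj)⟩

/-- Viewed in the fraction field of k[G], x is integral over k[G], hence some f in k[G]. This f is
integral over k[M], so each of its exponents has a positive multiple in M and thus lies in M. -/
lemma isIntegral_mem_range_of_fields [IsIntegrallyClosed (AddMonoidAlgebra k G)]
    (hsep : ∀ v w : G, v ≠ w → ∃ χ : Multiplicative G →* k, χ (.ofAdd v) ≠ χ (.ofAdd w))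
    (hφ : Function.Injective φ)
    (h : ∀ (g : G) (d : ℕ), 0 < d → d • g ∈ Set.range φ → g ∈ Set.range φ)
    (K L : Type*) [Field K] [Field L] [Algebra (AddMonoidAlgebra k M) K]
    [IsFractionRing (AddMonoidAlgebra k M) K]
    [Algebra (AddMonoidAlgebra k G) L] [IsFractionRing (AddMonoidAlgebra k G) L]
    {x : K} (hx : IsIntegral (AddMonoidAlgebra k M) x) :
    ∃ y, algebraMap (AddMonoidAlgebra k M) K y = x := by
  obtain ⟨J, hJ⟩ := exists_fractionField_hom (K := K) (L := L) (mapDomainRingHom k φ)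
    (mapDomain_injective hφ)
  obtain ⟨p, hp, hpx⟩ := hx
  have hpJ : p.eval₂ ((algebraMap _ L).comp (mapDomainRingHom k φ)) (J x) = 0 := by
    rw [← hJ, ← Polynomial.hom_eval₂, hpx, map_zero]
  have hint : IsIntegral (AddMonoidAlgebra k G) (J x) :=
    ⟨p.map (mapDomainRingHom k φ), hp.map _, by rwa [Polynomial.eval₂_map]⟩
  obtain ⟨f, hf⟩ := IsIntegrallyClosed.isIntegral_iff.1 hint
  have hfint : (mapDomainRingHom k φ).IsIntegralElem f := by
    refine ⟨p, hp, IsFractionRing.injective _ L ?_⟩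
    rw [Polynomial.hom_eval₂, hf, map_zero]
    exact hpJ
  have hsupp : (f.coeff.support : Set G) ⊆ Set.range φ := by
    intro v hv
    obtain ⟨d, hd, hdv⟩ := exists_nsmul_mem_of_isIntegralElem_single φ
      (isIntegralElem_single φ hsep f hfint hv)
    exact h v d hd hdv
  refine ⟨comapDomain φ hφ f, J.injective ?_⟩
  rw [← RingHom.comp_apply, hJ, ← hf]
  exact congrArg _ (mapDomain_comapDomain hsupp hφ)

/-- Let `M` be a submonoid of a free abelian group `G` that it generates. The monoid algebra `k[M]`
is integrally closed iff every element of `G` with a positive multiple in `M` lies in `M`. -/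
theorem isIntegrallyClosed_iff_of_generates [Module.Free ℤ G] [UniqueSums G]
    (hsep : ∀ v w : G, v ≠ w → ∃ χ : Multiplicative G →* k, χ (.ofAdd v) ≠ χ (.ofAdd w))
    (hφ : Function.Injective φ) (hgen : ∀ g : G, ∃ a b : M, g + φ b = φ a) :
    IsIntegrallyClosed (AddMonoidAlgebra k M) ↔
      ∀ (g : G) (d : ℕ), 0 < d → d • g ∈ Set.range φ → g ∈ Set.range φ := by
  have : UniqueSums M := .of_injective_addHom φ.toAddHom hφ inferInstance
  have := isIntegrallyClosed_of_free (k := k) G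
  refine ⟨fun h g d hd => mem_range_of_nsmul_mem_range φ hφ hgen h hd, fun h => ?_⟩
  exact (isIntegrallyClosed_iff (FractionRing (AddMonoidAlgebra k M))).2 fun hx =>
    isIntegral_mem_range_of_fields φ hsep hφ h _ (FractionRing (AddMonoidAlgebra k G)) hx

end Integral

end AddMonoidAlgebra

namespace OrbitClosure

/-! ### Characters of the torus and their linear independence -/

section Torus

variable {n : ℕ}

lemma coe_eq_diagonal (h : diagTorus n) :
    ((h : GL (Fin n) ℂ) : Matrix (Fin n) (Fin n) ℂ) = Matrix.diagonal (coord h) :=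
  ((Matrix.isDiag_iff_diagonal_diag _).1 h.2).symm

lemma coord_mul (g h : diagTorus n) (j : Fin n) : coord (g * h) j = coord g j * coord h j := by
  have : coord (g * h) j = (Matrix.diagonal (coord g) * Matrix.diagonal (coord h)) j j := by
    rw [← coe_eq_diagonal, ← coe_eq_diagonal]
    rfl
  simpa using this

lemma coord_one (j : Fin n) : coord (1 : diagTorus n) j = 1 := by
  simp [coord]

lemma coord_ne_zero (h : diagTorus n) (j : Fin n) : coord h j ≠ 0 := by
  intro h0
  have := coord_mul h h⁻¹ j
  rw [mul_inv_cancel, coord_one, h0, zero_mul] at this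
  exact one_ne_zero this

lemma exists_coord_eq (t : Fin n → ℂ) (ht : ∀ j, t j ≠ 0) :
    ∃ h : diagTorus n, ∀ j, coord h j = t j :=
  ⟨⟨Matrix.GeneralLinearGroup.mkOfDetNeZero (Matrix.diagonal t)
    (by simpa [Matrix.det_diagonal, Finset.prod_ne_zero_iff] using ht),
    Matrix.isDiag_diagonal t⟩, fun j => Matrix.diagonal_apply_eq t j⟩

/-- The Laurent monomial of exponent `a`, as a character of the torus. -/
noncomputable def monomialChar (a : Fin n → ℤ) : diagTorus n →* ℂ where
  toFun h := ∏ j, coord h j ^ a j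
  map_one' := by simp [coord_one]
  map_mul' g h := by simp [coord_mul, mul_zpow, Finset.prod_mul_distrib]

lemma monomialChar_apply (a : Fin n → ℤ) (h : diagTorus n) :
    monomialChar a h = ∏ j, coord h j ^ a j := rfl

lemma monomialChar_injective : Function.Injective (monomialChar (n := n)) := by
  intro a b hab
  ext j
  obtain ⟨h, hh⟩ := exists_coord_eq (fun i : Fin n => if i = j then (2 : ℂ) else 1)
    (fun i => by split_ifs <;> simp)
  have key : ∀ c : Fin n → ℤ, monomialChar c h = 2 ^ c j := by
    intro c
    rw [monomialChar_apply, Finset.prod_eq_single j]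
    · simp [hh]
    · intro i _ hi
      simp [hh, hi]
    · simp
  have h2 : (2 : ℂ) ^ a j = 2 ^ b j := by rw [← key, ← key, hab]
  -- Injectivity of integer powers of 2 uses the order on ℝ.
  have h3 : (2 : ℝ) ^ a j = 2 ^ b j :=
    Complex.ofReal_injective (by push_cast; exact h2)
  exact zpow_right_injective₀ (by norm_num) (by norm_num) h3

/-- The character `a ↦ hᵃ` of `ℤⁿ` given by a point of the torus. -/
noncomputable def latticeChar (h : diagTorus n) : Multiplicative (Fin n → ℤ) →* ℂ where
  toFun a := monomialChar a.toAdd h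
  map_one' := by simp [monomialChar_apply]
  map_mul' a b := by
    simp [monomialChar_apply, zpow_add₀ (coord_ne_zero h _), Finset.prod_mul_distrib]

lemma linearIndependent_monomialChar :
    LinearIndependent ℂ (fun (a : Fin n → ℤ) => (monomialChar a : diagTorus n → ℂ)) :=
  (linearIndependent_monoidHom (diagTorus n) ℂ).comp _ monomialChar_injective

/-- An algebraic character of the torus is a Laurent monomial. -/
theorem IsAlgebraic.exists_hasExponent {χ : diagTorus n →* ℂˣ} (hχ : IsAlgebraic χ) :
    ∃ a, HasExponent χ a := by
  obtain ⟨p, k, hp⟩ := hχ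
  let ψ : diagTorus n →* ℂ := (Units.coeHom ℂ).comp χ
  by_contra hne
  have hψ : ψ ∉ Set.range (monomialChar (n := n)) := by
    rintro ⟨a, ha⟩
    exact hne ⟨a, fun h => (DFunLike.congr_fun ha h).symm⟩
  -- By Dedekind, a character outside a set of characters is not in their span; but the formula for
  -- χ is a combination of Laurent monomials.
  refine (linearIndependent_monoidHom (diagTorus n) ℂ).notMem_span_image hψ ?_
  have hsum : (ψ : diagTorus n → ℂ) =
      ∑ d ∈ p.support, p.coeff d • (monomialChar (fun j => (d j : ℤ) - k) : diagTorus n → ℂ) := by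
    ext h
    have : ψ h = MvPolynomial.eval (coord h) p / (∏ j, coord h j) ^ k := hp h
    rw [this, MvPolynomial.eval_eq', Finset.sum_div, Finset.sum_apply]
    refine Finset.sum_congr rfl fun d _ => ?_
    rw [Pi.smul_apply, smul_eq_mul, mul_div_assoc, monomialChar_apply, ← Finset.prod_pow,
      ← Finset.prod_div_distrib]
    congr 1
    refine Finset.prod_congr rfl fun j _ => ?_
    rw [zpow_sub₀ (coord_ne_zero h j), zpow_natCast, zpow_natCast]
  rw [hsum]
  exact Submodule.sum_mem _ fun d _ => Submodule.smul_mem _ _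
    (Submodule.subset_span ⟨_, ⟨_, rfl⟩, rfl⟩)

lemma HasExponent.unique {χ : diagTorus n →* ℂˣ} {a b : Fin n → ℤ} (ha : HasExponent χ a)
    (hb : HasExponent χ b) : a = b :=
  monomialChar_injective (MonoidHom.ext fun h => (ha h).symm.trans (hb h))

/-- Evaluation of an element of `ℂ[S]`, for `S ⊆ ℤⁿ`, at a point of the torus. -/
noncomputable def torusEval (S : AddSubmonoid (Fin n → ℤ)) (h : diagTorus n) :
    AddMonoidAlgebra ℂ S →ₐ[ℂ] ℂ :=
  AddMonoidAlgebra.lift ℂ ℂ S ((latticeChar h).comp S.subtype.toMultiplicative)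

lemma torusEval_single (S : AddSubmonoid (Fin n → ℤ)) (h : diagTorus n) (a : S) (c : ℂ) :
    torusEval S h (.single a c) = c * monomialChar a h := by
  rw [torusEval, AddMonoidAlgebra.lift_single]
  rfl

/-- As a function on the torus, f is a combination of distinct characters whose coefficients are
those of f. -/
lemma eq_zero_of_torusEval_eq_zero (S : AddSubmonoid (Fin n → ℤ)) (f : AddMonoidAlgebra ℂ S)
    (hf : ∀ h, torusEval S h f = 0) : f = 0 := by
  have hli : LinearIndependent ℂ (fun a : S => (monomialChar a.1 : diagTorus n → ℂ)) :=
    linearIndependent_monomialChar.comp _ Subtype.val_injective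
  refine AddMonoidAlgebra.coeff_injective (linearIndependent_iff.1 hli f.coeff ?_)
  ext h
  have := hf h
  rw [torusEval, AddMonoidAlgebra.lift_apply] at this
  rw [Finsupp.linearCombination_apply, Finsupp.sum, Finset.sum_apply]
  exact this

end Torus

/-! ### Presentations of an algebra and algebraic sets -/

section Presentation

open MvPolynomial

variable {σ τ R : Type*} [CommRing R] [Algebra ℂ R]

/-- Two presentations of the same algebra define isomorphic algebraic sets. -/
theorem varietyIso_zeroLocus_ker (Φ : MvPolynomial σ ℂ →ₐ[ℂ] R) (Ψ : MvPolynomial τ ℂ →ₐ[ℂ] R)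
    (hΦ : Function.Surjective Φ) (hΨ : Function.Surjective Ψ) :
    VarietyIso (zeroLocus ℂ (RingHom.ker Φ)) (zeroLocus ℂ (RingHom.ker Ψ)) := by
  choose f hf using fun j : τ => hΦ (Ψ (X j))
  choose g hg using fun i : σ => hΨ (Φ (X i))
  have hcomp_f : ∀ q, Φ (aeval f q) = Ψ q := fun q =>
    DFunLike.congr_fun (f := Φ.comp (aeval f)) (g := Ψ) (by ext j; simp [hf]) q
  have hcomp_g : ∀ p, Ψ (aeval g p) = Φ p := fun p =>
    DFunLike.congr_fun (f := Ψ.comp (aeval g)) (g := Φ) (by ext i; simp [hg]) p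
  have eval_f : ∀ (x : σ → ℂ) q, aeval (fun j => eval x (f j)) q = aeval x (aeval f q) :=
    fun x q => DFunLike.congr_fun (f := aeval fun j => eval x (f j)) (g := (aeval x).comp (aeval f))
      (by ext j; simp [aeval_eq_eval]) q
  have eval_g : ∀ (y : τ → ℂ) p, aeval (fun i => eval y (g i)) p = aeval y (aeval g p) :=
    fun y p => DFunLike.congr_fun (f := aeval fun i => eval y (g i)) (g := (aeval y).comp (aeval g))
      (by ext i; simp [aeval_eq_eval]) p
  refine ⟨f, g, fun x hx q hq => ?_, fun y hy p hp => ?_, fun x hx => ?_, fun y hy => ?_⟩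
  · rw [eval_f]
    exact hx _ (by rwa [RingHom.mem_ker, hcomp_f])
  · rw [eval_g]
    exact hy _ (by rwa [RingHom.mem_ker, hcomp_g])
  · ext i
    -- The composite is the identity only modulo the kernel, which is enough at points of the zero
    -- locus.
    have := hx (aeval f (g i) - X i) (by rw [RingHom.mem_ker, map_sub, hcomp_f, hg, sub_self])
    rw [map_sub, ← eval_f, aeval_X, sub_eq_zero] at this
    exact this
  · ext j
    have := hy (aeval g (f j) - X j) (by rw [RingHom.mem_ker, map_sub, hcomp_g, hf, sub_self])
    rw [map_sub, ← eval_g, aeval_X, sub_eq_zero] at this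
    exact this

lemma vanishingIdeal_zariskiClosure (S : Set (σ → ℂ)) :
    vanishingIdeal ℂ (zariskiClosure S) = vanishingIdeal ℂ S :=
  zeroLocus_vanishingIdeal_galoisConnection.u_l_u_eq_u S

end Presentation

/-! ### The semigroup ℕ(A), the lattice ℤ(A) and the rational cone -/

section Lattice

variable {n : ℕ} {A : Set (Fin n → ℤ)}

lemma surjective_of_single_mem_range {σ : Type*}
    (Φ : MvPolynomial σ ℂ →ₐ[ℂ] SemigroupAlgebra A)
    (hΦ : ∀ a (ha : a ∈ A),
      AddMonoidAlgebra.single ⟨a, AddSubmonoid.subset_closure ha⟩ 1 ∈ Φ.range) :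
    Function.Surjective Φ := by
  have key : ∀ a (ha : a ∈ AddSubmonoid.closure A),
      (AddMonoidAlgebra.single ⟨a, ha⟩ 1 : SemigroupAlgebra A) ∈ Φ.range := by
    intro a ha
    induction ha using AddSubmonoid.closure_induction with
    | mem a ha => exact hΦ a ha
    | zero => exact one_mem _
    | add a b ha hb iha ihb =>
      convert! mul_mem iha ihb using 1
      simp [AddMonoidAlgebra.single_mul_single]
  intro f
  change f ∈ Φ.range
  induction f using AddMonoidAlgebra.induction_linear with
  | zero => exact zero_mem _
  | add f g hf hg => exact add_mem hf hg
  | single a c =>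
    convert! Φ.range.smul_mem (key a.1 a.2) c using 1
    simp

/-- The inclusion `ℕ(A) → ℤ(A)`. -/
def closureInclusion (A : Set (Fin n → ℤ)) :
    AddSubmonoid.closure A →+ AddSubgroup.closure A :=
  (AddSubmonoid.closure A).subtype.codRestrict (AddSubgroup.closure A)
    fun a => AddSubgroup.le_closure_toAddSubmonoid A a.2

lemma mem_range_closureInclusion {g : AddSubgroup.closure A} :
    g ∈ Set.range (closureInclusion A) ↔ (g : Fin n → ℤ) ∈ AddSubmonoid.closure A :=
  ⟨by rintro ⟨a, rfl⟩; exact a.2, fun h => ⟨⟨g, h⟩, rfl⟩⟩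

lemma exists_add_closureInclusion_eq (g : AddSubgroup.closure A) :
    ∃ a b, g + closureInclusion A b = closureInclusion A a := by
  obtain ⟨g, hg⟩ := g
  have : ∃ a b : AddSubmonoid.closure A, g + b.1 = a.1 := by
    induction hg using AddSubgroup.closure_induction with
    | mem a ha => exact ⟨⟨a, AddSubmonoid.subset_closure ha⟩, 0, by simp⟩
    | zero => exact ⟨0, 0, by simp⟩
    | add x y hx hy ihx ihy =>
      obtain ⟨a, b, h⟩ := ihx
      obtain ⟨c, d, h'⟩ := ihy
      exact ⟨a + c, b + d, by simp [← h, ← h']; abel⟩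
    | neg x hx ih =>
      obtain ⟨a, b, h⟩ := ih
      exact ⟨b, a, by simp [← h]⟩
  obtain ⟨a, b, h⟩ := this
  exact ⟨a, b, Subtype.ext h⟩

lemma cast_mem_rationalCone_of_mem {v : Fin n → ℤ} (hv : v ∈ AddSubmonoid.closure A) :
    (fun j => (v j : ℚ)) ∈
      PointedCone.hull ℚ ((fun (a : Fin n → ℤ) (j : Fin n) => (a j : ℚ)) '' A) := by
  induction hv using AddSubmonoid.closure_induction with
  | mem a ha => exact Submodule.subset_span ⟨a, ha, rfl⟩
  | zero =>
    convert! Submodule.zero_mem (PointedCone.hull ℚ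
      ((fun (a : Fin n → ℤ) (j : Fin n) => (a j : ℚ)) '' A))
  | add a b _ _ iha ihb => simpa using! Submodule.add_mem _ iha ihb

/-- An integral vector lies in the rational cone iff a positive multiple lies in `ℕ(A)`. -/
lemma cast_mem_rationalCone_iff {v : Fin n → ℤ} :
    (fun j => (v j : ℚ)) ∈ rationalCone A ↔ ∃ d, 0 < d ∧ d • v ∈ AddSubmonoid.closure A := by
  constructor
  · intro h
    have key : ∀ x ∈ PointedCone.hull ℚ ((fun (a : Fin n → ℤ) (j : Fin n) => (a j : ℚ)) '' A),
        ∃ d : ℕ, 0 < d ∧ ∃ w ∈ AddSubmonoid.closure A, ∀ j, (d : ℚ) * x j = (w j : ℚ) := by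
      intro x hx
      induction hx using Submodule.span_induction with
      | mem x hx =>
        obtain ⟨a, ha, rfl⟩ := hx
        exact ⟨1, one_pos, a, AddSubmonoid.subset_closure ha, by simp⟩
      | zero => exact ⟨1, one_pos, 0, zero_mem _, by simp⟩
      | add x y _ _ ihx ihy =>
        obtain ⟨d, hd, w, hw, h⟩ := ihx
        obtain ⟨e, he, u, hu, h'⟩ := ihy
        refine ⟨d * e, by positivity, e • w + d • u,
          add_mem (nsmul_mem hw _) (nsmul_mem hu _), fun j => ?_⟩
        simp [← h, ← h']
        ring
      | smul q x _ ih =>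
        obtain ⟨d, hd, w, hw, h⟩ := ih
        obtain ⟨q, hq⟩ := q
        -- The denominator of q joins the multiplier; its numerator, non-negative since q is, scales
        -- w.
        refine ⟨q.den * d, Nat.mul_pos q.den_pos hd, q.num.toNat • w, nsmul_mem hw _, fun j => ?_⟩
        have h1 : ((q.num.toNat : ℤ) : ℚ) = q * q.den := by
          rw [Int.toNat_of_nonneg (Rat.num_nonneg.2 hq), Rat.mul_den_eq_num]
        have h2 : (q.num.toNat : ℚ) = q * q.den := by exact_mod_cast h1
        have h3 : ((⟨q, hq⟩ : {c : ℚ // 0 ≤ c}) • x) j = q * x j := rfl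
        rw [h3, Pi.smul_apply, nsmul_eq_mul, Int.cast_mul, Int.cast_natCast, ← h, h2, Nat.cast_mul]
        ring
    obtain ⟨d, hd, w, hw, h⟩ := key _ h
    refine ⟨d, hd, ?_⟩
    convert hw
    ext j
    have := h j
    simp
    exact_mod_cast this
  · rintro ⟨d, hd, h⟩
    have := Submodule.smul_mem _ (⟨(d : ℚ)⁻¹, by positivity⟩ : {c : ℚ // 0 ≤ c})
      (cast_mem_rationalCone_of_mem h)
    convert! this using 1
    ext j
    change _ = (d : ℚ)⁻¹ * _
    have : (d : ℚ) ≠ 0 := by positivity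
    simp [inv_mul_cancel_left₀ this]

lemma isSaturated_iff : IsSaturated A ↔ ∀ (g : AddSubgroup.closure A) (d : ℕ), 0 < d →
    d • g ∈ Set.range (closureInclusion A) → g ∈ Set.range (closureInclusion A) := by
  simp only [mem_range_closureInclusion]
  constructor
  · intro h g d hd hg
    exact h.subset ⟨g.2, cast_mem_rationalCone_iff.2 ⟨d, hd, hg⟩⟩
  · intro h
    refine Set.Subset.antisymm ?_ fun v hv => ⟨AddSubgroup.le_closure_toAddSubmonoid A hv,
      cast_mem_rationalCone_of_mem hv⟩
    rintro v ⟨hv, hc⟩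
    obtain ⟨d, hd, hdv⟩ := cast_mem_rationalCone_iff.1 hc
    exact h ⟨v, hv⟩ d hd hdv

/-- The semigroup algebra `ℂ[ℕ(A)]` is integrally closed iff `A` is saturated. -/
theorem isIntegrallyClosed_semigroupAlgebra_iff (A : Set (Fin n → ℤ)) :
    IsIntegrallyClosed (SemigroupAlgebra A) ↔ IsSaturated A := by
  have : UniqueSums (AddSubgroup.closure A) :=
    .of_injective_addHom (AddSubgroup.closure A).subtype.toAddHom Subtype.val_injective inferInstance
  have : Module.Free ℤ (AddSubgroup.closure A) :=
    inferInstanceAs (Module.Free ℤ (AddSubgroup.toIntSubmodule (AddSubgroup.closure A)))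
  rw [isSaturated_iff]
  refine AddMonoidAlgebra.isIntegrallyClosed_iff_of_generates (closureInclusion A) ?_ ?_
    exists_add_closureInclusion_eq
  · intro v w hvw
    have hne : monomialChar v.1 ≠ monomialChar w.1 :=
      fun h => hvw (Subtype.ext (monomialChar_injective h))
    obtain ⟨h, hh⟩ := DFunLike.ne_iff.1 hne
    exact ⟨(latticeChar h).comp (AddSubgroup.closure A).subtype.toMultiplicative, hh⟩
  · intro a b hab
    exact Subtype.ext (congrArg (fun g : AddSubgroup.closure A => (g : Fin n → ℤ)) hab)

lemma isDomain_semigroupAlgebra (A : Set (Fin n → ℤ)) : IsDomain (SemigroupAlgebra A) :=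
  have : UniqueSums (AddSubmonoid.closure A) :=
    .of_injective_addHom (AddSubmonoid.closure A).subtype.toAddHom Subtype.val_injective
      inferInstance
  inferInstance

end Lattice

/-! ### The ideal of the orbit -/

section Orbit

open MvPolynomial

variable {n m : ℕ} {χ : Fin m → (diagTorus n →* ℂˣ)} {e : Fin m → Fin n → ℤ}

open Classical in
/-- The homomorphism `ℂ[x₁, …, xₘ] → ℂ[ℕ(A)]` dual to the orbit map, `xᵢ ↦ zᵢ χᵢ`. -/
noncomputable def orbitHom (he : ∀ i, HasExponent (χ i) (e i)) (z : Fin m → ℂ) :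
    MvPolynomial (Fin m) ℂ →ₐ[ℂ] SemigroupAlgebra (supportCharacters χ z) :=
  aeval fun i => if h : z i ≠ 0 then
    .single ⟨e i, AddSubmonoid.subset_closure ⟨i, h, he i⟩⟩ (z i) else 0

lemma torusEval_orbitHom (he : ∀ i, HasExponent (χ i) (e i)) (z : Fin m → ℂ) (h : diagTorus n)
    (p : MvPolynomial (Fin m) ℂ) :
    torusEval _ h (orbitHom he z p) = aeval (fun i => (χ i h : ℂ) * z i) p := by
  refine DFunLike.congr_fun (f := (torusEval _ h).comp (orbitHom he z))
    (g := aeval fun i => (χ i h : ℂ) * z i) ?_ p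
  ext i
  by_cases hz : z i = 0
  · simp [orbitHom, hz]
  · simp [orbitHom, hz, torusEval_single, he i h, monomialChar_apply, mul_comm]

lemma vanishingIdeal_torusOrbit (he : ∀ i, HasExponent (χ i) (e i)) (z : Fin m → ℂ) :
    vanishingIdeal ℂ (torusOrbit χ z) = RingHom.ker (orbitHom he z) := by
  ext p
  rw [mem_vanishingIdeal_iff, RingHom.mem_ker]
  constructor
  · intro h
    refine eq_zero_of_torusEval_eq_zero _ _ fun t => ?_
    rw [torusEval_orbitHom]
    exact h _ ⟨t, rfl⟩
  · rintro h _ ⟨t, rfl⟩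
    rw [← torusEval_orbitHom he, h, map_zero]

lemma orbitHom_surjective (he : ∀ i, HasExponent (χ i) (e i)) (z : Fin m → ℂ) :
    Function.Surjective (orbitHom he z) := by
  refine surjective_of_single_mem_range _ ?_
  rintro a ⟨i, hz, hi⟩
  -- Membership in A gives only some exponent vector of `χ i`; uniqueness makes it the chosen `e i`.
  obtain rfl := hi.unique (he i)
  refine ⟨(z i)⁻¹ • X i, ?_⟩
  change orbitHom he z _ = _
  simp [orbitHom, hz]

end Orbit

end OrbitClosure

theorem proposition5p1 {n m : ℕ} (χ : Fin m → (OrbitClosure.diagTorus n →* ℂˣ))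
    (hχ : ∀ i, OrbitClosure.IsAlgebraic (χ i)) (z : Fin m → ℂ) :
    OrbitClosure.VarietyIso (OrbitClosure.orbitClosure χ z)
        (OrbitClosure.affineToricVariety (OrbitClosure.supportCharacters χ z)) ∧
      Nonempty (OrbitClosure.CoordRing (OrbitClosure.orbitClosure χ z) ≃ₐ[ℂ]
        OrbitClosure.SemigroupAlgebra (OrbitClosure.supportCharacters χ z)) ∧
      (OrbitClosure.IsNormalVariety (OrbitClosure.orbitClosure χ z) ↔
        OrbitClosure.IsSaturated (OrbitClosure.supportCharacters χ z)) := by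
  choose e he using fun i => (hχ i).exists_hasExponent
  have hker := OrbitClosure.vanishingIdeal_torusOrbit he z
  have hsurj := OrbitClosure.orbitHom_surjective he z
  have eqv : OrbitClosure.CoordRing (OrbitClosure.orbitClosure χ z) ≃ₐ[ℂ]
      OrbitClosure.SemigroupAlgebra (OrbitClosure.supportCharacters χ z) :=
    (Ideal.quotientEquivAlgOfEq ℂ
      ((OrbitClosure.vanishingIdeal_zariskiClosure _).trans hker)).trans
      (Ideal.quotientKerAlgEquivOfSurjective hsurj)
  refine ⟨?_, ⟨eqv⟩, ?_⟩
  · rw [OrbitClosure.orbitClosure, OrbitClosure.zariskiClosure, hker]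
    refine OrbitClosure.varietyIso_zeroLocus_ker _ _ hsurj
      (OrbitClosure.surjective_of_single_mem_range _ fun a ha => ?_)
    exact ⟨MvPolynomial.X ⟨a, ha⟩, MvPolynomial.aeval_X _ _⟩
  · rw [← OrbitClosure.isIntegrallyClosed_semigroupAlgebra_iff]
    have hdom := OrbitClosure.isDomain_semigroupAlgebra (OrbitClosure.supportCharacters χ z)
    constructor
    · rintro ⟨_, h⟩
      exact .of_equiv eqv.toRingEquiv
    · intro h
      exact ⟨eqv.toMulEquiv.isDomain _, .of_equiv eqv.symm.toRingEquiv⟩
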